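/- All Banach spaces are real. Let $X$ be a separable Banach space with dual $X^*$, unit sphere $S_{X^*}$ and closed dual unit ball $B_{X^*}$. **Definitions.** *Finite sequences.* Sequences $(x_i)_{i=1}^n$, $(y_i)_{i=1}^n$ in normed spaces are *$C$-equivalent* if there are $A,B>0$ with $AB\le C$ and $\frac1A\|\sum a_iy_i\|\le\|\sum a_ix_i\|\le B\|\sum a_iy_i\|$ for all real $a_i$; $(x_i)_{i=1}^n$ is *$C$-unconditional* if $\|\sum\theta_ia_ix_i\|\le C\|\sum a_ix_i\|$ for all real $a_i$ and signs $\theta_i\in\{-1,1\}$. An infinite sequence is *$D$-basic* if it is a Schauder basis of its closed linear span with basis constant at most $D$. *Szlenk index.* For $\varepsilon>0$ and $K\subset X^*$ let $s_\varepsilon(K)$ be $K$ minus the union of all relatively weak$^*$-open subsets of $K$ of norm diameter at most $\varepsilon$. Put $s_\varepsilon^0(K)=K$, $s_\varepsilon^{\alpha+1}(K)=s_\varepsilon(s_\varepsilon^\alpha(K))$, and $s^\alpha_\varepsilon(K)=\bigcap_{\beta<\alpha}s^\beta_\varepsilon(K)$ for limit ordinals $\alpha$. Let $S_Z(K,\varepsilon)$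 be the least $\alpha$ with $s_\varepsilon^\alpha(K)=\emptyset$ ($\infty$ if there is none), and $S_Z(X)=\sup_{\varepsilon>0}S_Z(B_{X^*},\varepsilon)$. *Asymptotic structure.* Let $\mathrm{cof}^*$ be the set of weak$^*$-closed subspaces of $X^*$ of finite codimension, and for $Y\in \mathrm{cof}^*$ let $S_Y=Y\cap S_{X^*}$. The space $X^*$ has a *weak$^*$ unconditional asymptotic structure* if there is a constant $C\ge1$ such that for every $n\ge1$: $\exists X_1\in\mathrm{cof}^*\ \forall x_1^*\in S_{X_1}\ \dots\ \exists X_n\in\mathrm{cof}^*\ \forall x_n^*\in S_{X_n}$, the sequence $(x_i^*)_{i=1}^n$ is $C$-unconditional. An $n$-dimensional normed space $E$ with a normalized basis $(e_i)_{i=1}^n$ belongs to *the $n$-th weak$^*$ asymptotic structure* $\{X^*\}^{w^*}_n$ if for every $\varepsilon>0$: $\forall X_1\in\mathrm{cof}^*\ \exists x_1^*\in S_{X_1}\ \dots\ \forall X_n\in\mathrm{cof}^*\ \exists x_n^*\in S_{X_n}$ such that $(x_i^*)_{i=1}^n$ is $(1+\varepsilon)$-equivalent to $(e_i)_{i=1}^n$.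 *Good trees.* Let $T_N$ be the set of finite sequences of natural numbers of length at most $N$ (including $\emptyset$). A *compatible linear ordering* of $T_N$ is an enumeration $(\sigma_i)_{i\geq 1}$ of $T_N$, without repetition, in which every strict initial segment of $\sigma_i$ occurs before $\sigma_i$. A family $(x_s)_{s\in T_N}$ in a Banach space $Z$ is a *$(C,D)$-good $\ell_\infty$-tree of height $N$* with respect to $(\sigma_i)$ if $\|x_s\|=1$ for all $s$; for every $s\in T_N$ of length $N$ the branch $(x_{s|_0},x_{s|_1},\dots,x_{s|_N})$ is $C^2$-equivalent to the unit vector basis of $\ell_\infty^{N+1}$ (where $s|_k$ is the initial segment of $s$ of length $k$); and $(x_{\sigma_i})_{i\geq 1}$ is $D$-basic. The space $Z$ *contains good $\ell_\infty$-trees of arbitrary height almost isometrically* if for every $N\ge1$, every $\varepsilon>0$ and every compatible linear ordering $(\sigma_i)$ of $T_N$, there is a $(1+\varepsilon,1+\varepsilon)$-good $\ell_\infty$-tree of height $N$ in $Z$ with respect to $(\sigma_i)$. **Theorem.** Let $X$ be a separable real Banach space with $S_Z(X)>\omega$, and assume that $X^*$ has a weak$^*$ unconditional asymptotic structure. Then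 $\ell_\infty^n$, with its unit vector basis, belongs to $\{X^*\}^{w^*}_n$ for every $n\ge1$. Moreover, $X^*$ contains good $\ell_\infty$-trees of arbitrary height almost isometrically. -/

import Mathlib

open scoped ENNReal

noncomputable section

namespace DualTrees

universe u v w

/-! ### Finite sequences in normed spaces -/

section Sequences

variable {E : Type v} [NormedAddCommGroup E] [NormedSpace ℝ E]
variable {F : Type w} [NormedAddCommGroup F] [NormedSpace ℝ F]
variable {n : ℕ}

/-- `(xᵢ)` and `(yᵢ)` are `C`-equivalent: there are `A, B > 0` with `A * B ≤ C` and
`A⁻¹ ‖∑ aᵢ yᵢ‖ ≤ ‖∑ aᵢ xᵢ‖ ≤ B ‖∑ aᵢ yᵢ‖` for all scalars `aᵢ`. -/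
def IsEquivalentSeq (C : ℝ) (x : Fin n → E) (y : Fin n → F) : Prop :=
  ∃ A B : ℝ, 0 < A ∧ 0 < B ∧ A * B ≤ C ∧ ∀ a : Fin n → ℝ,
    A⁻¹ * ‖∑ i, a i • y i‖ ≤ ‖∑ i, a i • x i‖ ∧
      ‖∑ i, a i • x i‖ ≤ B * ‖∑ i, a i • y i‖

/-- `(xᵢ)` is `C`-unconditional. -/
def IsUnconditionalSeq (C : ℝ) (x : Fin n → E) : Prop :=
  ∀ a θ : Fin n → ℝ, (∀ i, θ i = 1 ∨ θ i = -1) →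
    ‖∑ i, (θ i * a i) • x i‖ ≤ C * ‖∑ i, a i • x i‖

/-- `(xᵢ)` is `D`-basic: it is a Schauder basis of its closed linear span, with basis constant
at most `D`. -/
def IsBasicSeq (D : ℝ) (x : ℕ → E) : Prop :=
  ∃ b : SchauderBasis ℝ (Submodule.span ℝ (Set.range x)).topologicalClosure,
    (∀ i, ((b i : (Submodule.span ℝ (Set.range x)).topologicalClosure) : E) = x i) ∧
      ∀ k, ‖b.proj k‖ ≤ D

end Sequences

/-! ### Weak* asymptotic structure -/

section Asymptotic

variable (X : Type u) [NormedAddCommGroup X] [NormedSpace ℝ X]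

/-- The weak* closed subspaces of finite codimension of the dual of `X`. -/
def weakStarCof : Set (Submodule ℝ (WeakDual ℝ X)) :=
  {Y | IsClosed (Y : Set (WeakDual ℝ X)) ∧ FiniteDimensional ℝ (WeakDual ℝ X ⧸ Y)}

/-- The unit sphere, for the dual norm, of a subspace of the dual of `X`. -/
def dualSphere (Y : Submodule ℝ (WeakDual ℝ X)) : Set (StrongDual ℝ X) :=
  {f | StrongDual.toWeakDual f ∈ Y ∧ ‖f‖ = 1}

/-- `∀ X₁, ∃ x₁ ∈ S_{X₁}, …, ∀ Xₙ, ∃ xₙ ∈ S_{Xₙ}, P (x₁, …, xₙ)`, where the `Xᵢ` range over the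
weak* closed subspaces of finite codimension. -/
def ForallExistsGame : (n : ℕ) → ((Fin n → StrongDual ℝ X) → Prop) → Prop
  | 0, P => P Fin.elim0
  | n + 1, P => ∀ Y ∈ weakStarCof X, ∃ f ∈ dualSphere X Y,
      ForallExistsGame n fun g => P (Fin.cons f g)

/-- `∃ X₁, ∀ x₁ ∈ S_{X₁}, …, ∃ Xₙ, ∀ xₙ ∈ S_{Xₙ}, P (x₁, …, xₙ)`, where the `Xᵢ` range over the
weak* closed subspaces of finite codimension. -/
def ExistsForallGame : (n : ℕ) → ((Fin n → StrongDual ℝ X) → Prop) → Prop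
  | 0, P => P Fin.elim0
  | n + 1, P => ∃ Y ∈ weakStarCof X, ∀ f ∈ dualSphere X Y,
      ExistsForallGame n fun g => P (Fin.cons f g)

/-- The space `E`, with its normalized basis `e` of length `n`, is in the `n`-th weak* asymptotic
structure of the dual of `X` up to the constant `C`. -/
def InWeakStarAsymptoticStructureUpTo (C : ℝ) {n : ℕ} {E : Type v} [NormedAddCommGroup E]
    [NormedSpace ℝ E] (e : Module.Basis (Fin n) ℝ E) : Prop :=
  ∀ ε : ℝ, 0 < ε →
    ForallExistsGame X n fun f => IsEquivalentSeq (C * (1 + ε)) f (fun i => e i)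

/-- The space `E`, with its normalized basis `e` of length `n`, is in the `n`-th weak* asymptotic
structure of the dual of `X`. -/
def InWeakStarAsymptoticStructure {n : ℕ} {E : Type v} [NormedAddCommGroup E]
    [NormedSpace ℝ E] (e : Module.Basis (Fin n) ℝ E) : Prop :=
  InWeakStarAsymptoticStructureUpTo X 1 e

/-- The dual of `X` has a weak* unconditional asymptotic structure: for some `C ≥ 1` this holds with
constant `C`, in games of every length. -/
def HasWeakStarUnconditionalAsymptoticStructure : Prop :=
  ∃ C : ℝ, 1 ≤ C ∧ ∀ n : ℕ, 1 ≤ n →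
    ExistsForallGame X n fun f => IsUnconditionalSeq C f

end Asymptotic

/-! ### The Szlenk index -/

section Szlenk

variable {X : Type u} [NormedAddCommGroup X] [NormedSpace ℝ X]

/-- The derivation `s_ε`: remove from `K` all its relatively weak* open subsets of norm diameter at
most `ε`. -/
def szlenkDerivative (ε : ℝ) (K : Set (WeakDual ℝ X)) : Set (WeakDual ℝ X) :=
  K \ ⋃₀ {V | (∃ U : Set (WeakDual ℝ X), IsOpen U ∧ V = U ∩ K) ∧
    Metric.ediam (WeakDual.toStrongDual '' V) ≤ ENNReal.ofReal ε}

/-- The iterated derivations `s_ε^α`. -/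
def szlenkIterate (ε : ℝ) (K : Set (WeakDual ℝ X)) (α : Ordinal.{u}) : Set (WeakDual ℝ X) :=
  Ordinal.limitRecOn α K (fun _ L => szlenkDerivative ε L)
    (fun β _ L => ⋂ (γ : Ordinal.{u}) (h : γ < β), L γ h)

/-- `S_Z(K, ε)`, the least `α` with `s_ε^α(K) = ∅`, or `⊤` if there is none. -/
def szlenkIndexAt (ε : ℝ) (K : Set (WeakDual ℝ X)) : WithTop Ordinal.{u} :=
  ⨅ (α : Ordinal.{u}) (_ : szlenkIterate ε K α = ∅), (α : WithTop Ordinal.{u})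

/-- The Szlenk index of `X`: the supremum over `ε > 0` of `S_Z(B, ε)`, with `B` the closed unit ball
of the dual of `X`. -/
def szlenkIndex (X : Type u) [NormedAddCommGroup X] [NormedSpace ℝ X] : WithTop Ordinal.{u} :=
  ⨆ (ε : ℝ) (_ : 0 < ε),
    szlenkIndexAt ε (WeakDual.toStrongDual ⁻¹' Metric.closedBall (0 : StrongDual ℝ X) 1)

end Szlenk

/-! ### Good `ℓ_∞`-trees -/

section Trees

/-- The countably branching tree `T_N` of height `N`: finite sequences of natural numbers of length
at most `N`. -/
def CTree (N : ℕ) : Type := {s : List ℕ // s.length ≤ N}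

/-- The initial segment of length `min k |s|` of `s`. -/
def CTree.restrict {N : ℕ} (s : CTree N) (k : ℕ) : CTree N :=
  ⟨s.1.take k, (List.length_take_le' k s.1).trans s.2⟩

/-- An enumeration `σ` of `T_N` is a compatible linear ordering if every (strict) ancestor of `σ i`
is `σ j` for some `j < i`. -/
def IsCompatibleOrdering {N : ℕ} (σ : ℕ ≃ CTree N) : Prop :=
  ∀ i : ℕ, ∀ s : CTree N, s.1 <+: (σ i).1 → s ≠ σ i → ∃ j < i, s = σ j

/-- Compatible linear orderings exist. -/
theorem exists_isCompatibleOrdering {N : ℕ} (hN : 1 ≤ N) :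
    ∃ σ : ℕ ≃ CTree N, IsCompatibleOrdering σ := by
  let g : CTree N → ℕ := fun s => Encodable.encode s.1.reverse
  have hg : Function.Injective g := fun s t h => Subtype.ext (by simpa [g] using h)
  have key : ∀ l m : List ℕ, Encodable.encode l ≤ Encodable.encode (m ++ l) := by
    intro l m
    induction m with
    | nil => simp
    | cons a m ih =>
      refine ih.trans ?_
      rw [List.cons_append, Encodable.encode_list_cons]
      exact (Nat.right_le_pair _ _).trans (Nat.le_succ _)
  have : Infinite (CTree N) := Infinite.of_injective
    (fun k : ℕ => (⟨[k], by simpa using hN⟩ : CTree N)) fun a b h => by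
      simpa using congrArg Subtype.val h
  have : Infinite (Set.range g) := (Set.infinite_range_of_injective hg).to_subtype
  classical
  let o := Nat.Subtype.orderIsoOfNat (Set.range g)
  let e := Equiv.ofInjective g hg
  refine ⟨o.toEquiv.trans e.symm, fun i s hs hne => ⟨o.symm (e s), ?_, by simp⟩⟩
  have h1 : g s ≤ g (e.symm (o i)) := by
    obtain ⟨m, hm⟩ := hs
    have hm' : s.1 ++ m = (e.symm (o i)).1 := hm
    simp only [g, ← hm', List.reverse_append]
    exact key _ _
  have h2 : g s ≠ g (e.symm (o i)) := fun h => hne (hg h)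
  have h3 : e s < o i := by
    have : (e (e.symm (o i)) : ℕ) = g (e.symm (o i)) := rfl
    rw [Equiv.apply_symm_apply] at this
    exact Subtype.coe_lt_coe.1 (by rw [this]; exact lt_of_le_of_ne h1 h2)
  exact (OrderIso.symm_apply_lt _).2 h3

variable {E : Type v} [NormedAddCommGroup E] [NormedSpace ℝ E]

/-- `(x_s)` is a `(C, D)`-good `ℓ_∞`-tree of height `N` with respect to the ordering `σ`: it is
normalized, its branches `(x_∅, …, x_s)`, with `|s| = N`, are `C ^ 2`-equivalent to the unit vector
basis of `ℓ_∞^(N+1)`, and it is `D`-basic when enumerated by `σ`. -/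
def IsGoodEllInftyTree (C D : ℝ) {N : ℕ} (σ : ℕ ≃ CTree N) (x : CTree N → E) : Prop :=
  (∀ s, ‖x s‖ = 1) ∧
  (∀ s : CTree N, s.1.length = N →
    IsEquivalentSeq (C ^ 2) (fun i : Fin (N + 1) => x (s.restrict i))
      (fun i => Pi.basisFun ℝ (Fin (N + 1)) i)) ∧
  IsBasicSeq D fun i => x (σ i)

/-- `E` contains good `ℓ_∞`-trees of arbitrary height almost isometrically; the ordering with respect
to which they are good may be prescribed. -/
def ContainsGoodEllInftyTrees (E : Type v) [NormedAddCommGroup E] [NormedSpace ℝ E] : Prop :=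
  ∀ N : ℕ, 1 ≤ N → ∀ ε : ℝ, 0 < ε → ∀ σ : ℕ ≃ CTree N, IsCompatibleOrdering σ →
    ∃ x : CTree N → E, IsGoodEllInftyTree (1 + ε) (1 + ε) σ x

end Trees

end DualTrees

end

noncomputable section

namespace DualTrees

universe u v

/-! ### Weak* closed subspaces of finite codimension -/

section Cof

variable {X : Type u} [NormedAddCommGroup X] [NormedSpace ℝ X]

/-! Since the Szlenk index exceeds ω, for some ε > 0 every finite derivative of the dual ball is
nonempty. A point of the n-th derivative has, in every weak* neighbourhood, a point of the previous
derivative at norm distance at least ε/2. Descending through the derivatives wins a game that yields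
unit vectors `f i` and coefficients `r i ≥ ε/4` with `∑ r i • f i` bounded independently of n
(`forallExistsGame_of_mem_szlenkDerivative`). Unconditionality turns this single bound into an upper
ℓ_∞-estimate with a constant independent of n (`exists_upperGame`).

James' blocking argument, run on strategies, replaces the constant r² by r (`upperGame_of_sq`), so
iteration brings it below any number greater than 1. For unit vectors, an upper estimate near 1
forces a lower one by flipping signs (`isEquivalentSeq_basisFun`). This gives the asymptotic
structure.

For trees, a winning strategy is followed along every branch. Nodes are chosen in the prescribed
order, each in a weak* closed finite-codimensional subspace that almost complements the span of its
predecessors. Grünblum's criterion then bounds the basis constant. -/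

theorem top_mem_weakStarCof : (⊤ : Submodule ℝ (WeakDual ℝ X)) ∈ weakStarCof X :=
  ⟨isClosed_univ, Submodule.CoFG.top⟩

theorem inf_mem_weakStarCof {Y Z : Submodule ℝ (WeakDual ℝ X)} (hY : Y ∈ weakStarCof X)
    (hZ : Z ∈ weakStarCof X) : Y ⊓ Z ∈ weakStarCof X :=
  ⟨hY.1.inter hZ.1, Submodule.CoFG.inf hY.2 hZ.2⟩

theorem dualSphere_mono {Y Z : Submodule ℝ (WeakDual ℝ X)} (h : Y ≤ Z) :
    dualSphere X Y ⊆ dualSphere X Z :=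
  fun _ hf => ⟨h hf.1, hf.2⟩

/-- The common kernel of finitely many evaluations is weak* closed of finite codimension. -/
theorem exists_mem_weakStarCof_eval_eq_zero (t : Finset X) :
    ∃ Y ∈ weakStarCof X, ∀ f : StrongDual ℝ X, StrongDual.toWeakDual f ∈ Y → ∀ x ∈ t, f x = 0 := by
  let ev : WeakDual ℝ X →ₗ[ℝ] (t → ℝ) :=
    { toFun := fun f x => f x
      map_add' := fun _ _ => rfl
      map_smul' := fun _ _ => rfl }
  have hev : Continuous ev := continuous_pi fun x => WeakDual.eval_continuous (x : X)
  refine ⟨LinearMap.ker ev, ⟨?_, Submodule.CoFG.ker ev⟩, fun f hf x hx => ?_⟩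
  · exact isClosed_singleton.preimage hev
  · exact congrFun (LinearMap.mem_ker.1 hf) ⟨x, hx⟩

/-- Every functional can be moved into a given weak* closed subspace of finite codimension by
subtracting a functional that depends on it linearly and weak*-to-norm continuously. -/
theorem exists_continuous_linearMap_sub_mem {Y : Submodule ℝ (WeakDual ℝ X)}
    (hY : Y ∈ weakStarCof X) :
    ∃ g : WeakDual ℝ X →ₗ[ℝ] StrongDual ℝ X, Continuous g ∧
      ∀ u, u - StrongDual.toWeakDual (g u) ∈ Y := by
  obtain ⟨hc, hfd⟩ := hY
  -- Closedness makes the quotient Hausdorff, so every linear map from this finite-dimensional space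
  -- to the normed dual is continuous.
  have : IsClosed (Y : Set (WeakDual ℝ X)) := hc
  obtain ⟨s, hs⟩ := Y.mkQ.exists_rightInverse_of_surjective Y.range_mkQ
  let h : (WeakDual ℝ X ⧸ Y) →ₗ[ℝ] StrongDual ℝ X := WeakDual.toStrongDual.toLinearMap ∘ₗ s
  refine ⟨h ∘ₗ Y.mkQ, ?_, fun u => ?_⟩
  · exact (LinearMap.continuous_of_finiteDimensional h).comp continuous_quot_mk
  · refine (Submodule.Quotient.mk_eq_zero Y).1 ?_
    change Y.mkQ (u - s (Y.mkQ u)) = 0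
    rw [map_sub, sub_eq_zero]
    exact (LinearMap.congr_fun hs (Y.mkQ u)).symm

/-- A finite-dimensional subspace is almost monotonically complemented by a weak* closed subspace of
finite codimension. -/
theorem exists_mem_weakStarCof_norm_le (F : Submodule ℝ (StrongDual ℝ X)) [FiniteDimensional ℝ F]
    {c : ℝ} (hc : 1 < c) :
    ∃ Y ∈ weakStarCof X, ∀ u ∈ F, ∀ v : StrongDual ℝ X, StrongDual.toWeakDual v ∈ Y →
      ‖u‖ ≤ c * ‖u + v‖ := by
  have hc0 : 0 < c := one_pos.trans hc
  have hcompact : IsCompact (Metric.sphere (0 : F) 1) := isCompact_sphere 0 1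
  -- By compactness, finitely many points of the ball norm the sphere of `F` up to the factor `c⁻¹`.
  -- Functionals vanishing at these points do not disturb the estimate.
  let U : {x : X // ‖x‖ ≤ 1} → Set F := fun x => {u | c⁻¹ < (u : StrongDual ℝ X) x}
  obtain ⟨t, ht⟩ := hcompact.elim_finite_subcover U
    (fun x => isOpen_lt continuous_const (by
      exact ((ContinuousLinearMap.apply ℝ ℝ (x : X)).continuous.comp continuous_subtype_val)))
    (fun u hu => by
      have hu1 : ‖(u : StrongDual ℝ X)‖ = 1 := mem_sphere_zero_iff_norm.1 hu
      obtain ⟨x, hx, hxu⟩ := (u : StrongDual ℝ X).exists_lt_apply_of_lt_opNorm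
        (hu1.symm ▸ inv_lt_one_of_one_lt₀ hc : c⁻¹ < ‖(u : StrongDual ℝ X)‖)
      rw [Set.mem_iUnion]
      rcases le_total 0 ((u : StrongDual ℝ X) x) with h | h
      · exact ⟨⟨x, hx.le⟩, by simpa [U, Real.norm_of_nonneg h] using hxu⟩
      · exact ⟨⟨-x, by simpa using hx.le⟩, by simpa [U, Real.norm_of_nonpos h] using hxu⟩)
  classical
  obtain ⟨Y, hY, hYt⟩ := exists_mem_weakStarCof_eval_eq_zero (t.image Subtype.val)
  refine ⟨Y, hY, fun u hu v hv => ?_⟩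
  rcases eq_or_ne u 0 with rfl | hu0
  · simpa using mul_nonneg hc0.le (norm_nonneg v)
  have hn : 0 < ‖u‖ := norm_pos_iff.2 hu0
  have hmem : (⟨‖u‖⁻¹ • u, F.smul_mem _ hu⟩ : F) ∈ Metric.sphere (0 : F) 1 := by
    change dist (‖u‖⁻¹ • u) 0 = 1
    rw [dist_zero_right, norm_smul, norm_inv, norm_norm,
      inv_mul_cancel₀ hn.ne']
  obtain ⟨x, hxt, hx⟩ := Set.mem_iUnion₂.1 (ht hmem)
  have hx' : c⁻¹ < ‖u‖⁻¹ * u x := hx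
  have hvx : v x = 0 := hYt v hv x (Finset.mem_image_of_mem _ hxt)
  have h1 : u x ≤ ‖u + v‖ :=
    calc u x = (u + v) x := by simp [hvx]
      _ ≤ ‖(u + v) x‖ := le_abs_self _
      _ ≤ ‖u + v‖ * ‖(x : X)‖ := (u + v).le_opNorm _
      _ ≤ ‖u + v‖ := mul_le_of_le_one_right (norm_nonneg _) x.2
  rw [inv_lt_iff_one_lt_mul₀ hc0, mul_assoc, ← div_eq_inv_mul, one_lt_div hn, mul_comm] at hx'
  exact hx'.le.trans (mul_le_mul_of_nonneg_left h1 hc0.le)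

end Cof

/-! ### Games -/

section Games

variable {X : Type u} [NormedAddCommGroup X] [NormedSpace ℝ X]

theorem ForallExistsGame.mono {n : ℕ} {P Q : (Fin n → StrongDual ℝ X) → Prop}
    (hP : ForallExistsGame X n P) (h : ∀ f, P f → Q f) : ForallExistsGame X n Q := by
  induction n with
  | zero => exact h _ hP
  | succ n ih =>
    intro Y hY
    obtain ⟨f, hf, hg⟩ := hP Y hY
    exact ⟨f, hf, ih hg fun g hg => h _ hg⟩

/-- The two strategies run together: the winning one is applied to the intersection of the
opponent's subspace and the one required by `Q`. -/
theorem ForallExistsGame.and {n : ℕ} {P Q : (Fin n → StrongDual ℝ X) → Prop}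
    (hP : ForallExistsGame X n P) (hQ : ExistsForallGame X n Q) :
    ForallExistsGame X n fun f => P f ∧ Q f := by
  induction n with
  | zero => exact ⟨hP, hQ⟩
  | succ n ih =>
    intro Y hY
    obtain ⟨Z, hZ, hQ⟩ := hQ
    obtain ⟨f, hf, hg⟩ := hP _ (inf_mem_weakStarCof hY hZ)
    exact ⟨f, dualSphere_mono inf_le_left hf, ih hg (hQ f (dualSphere_mono inf_le_right hf))⟩

theorem ForallExistsGame.exists {n : ℕ} {P : (Fin n → StrongDual ℝ X) → Prop}
    (hP : ForallExistsGame X n P) : ∃ f, P f := by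
  induction n with
  | zero => exact ⟨_, hP⟩
  | succ n ih =>
    obtain ⟨f, -, hg⟩ := hP _ top_mem_weakStarCof
    obtain ⟨g, hg⟩ := ih hg
    exact ⟨_, hg⟩

/-- The games are determined. -/
theorem ExistsForallGame.of_not {n : ℕ} {P : (Fin n → StrongDual ℝ X) → Prop}
    (hP : ¬ ForallExistsGame X n P) : ExistsForallGame X n fun f => ¬ P f := by
  induction n with
  | zero => exact hP
  | succ n ih =>
    simp only [ForallExistsGame, not_forall, not_exists, not_and] at hP
    obtain ⟨Y, hY, h⟩ := hP
    exact ⟨Y, hY, fun f hf => ih (h f hf)⟩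

theorem ExistsForallGame.forall_mem (n : ℕ) {Y : Submodule ℝ (WeakDual ℝ X)}
    (hY : Y ∈ weakStarCof X) :
    ExistsForallGame X n fun f => ∀ i, StrongDual.toWeakDual (f i) ∈ Y := by
  -- The predicate is generalized because fixing the first move changes its shape in the induction.
  suffices ∀ P : (Fin n → StrongDual ℝ X) → Prop,
      (∀ f, (∀ i, StrongDual.toWeakDual (f i) ∈ Y) → P f) → ExistsForallGame X n P from
    this _ fun _ h => h
  induction n with
  | zero => exact fun P h => h _ fun i => i.elim0
  | succ n ih =>
    refine fun P h => ⟨Y, hY, fun f hf => ih _ fun g hg => h _ fun i => ?_⟩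
    induction i using Fin.cases with
    | zero => exact hf.1
    | succ i => exact hg i

theorem ExistsForallGame.forall_norm_eq_one (n : ℕ) :
    ExistsForallGame X n fun f => ∀ i, ‖f i‖ = 1 := by
  suffices ∀ P : (Fin n → StrongDual ℝ X) → Prop,
      (∀ f, (∀ i, ‖f i‖ = 1) → P f) → ExistsForallGame X n P from
    this _ fun _ h => h
  induction n with
  | zero => exact fun P h => h _ fun i => i.elim0
  | succ n ih =>
    refine fun P h => ⟨⊤, top_mem_weakStarCof, fun f hf => ih _ fun g hg => h _ fun i => ?_⟩
    induction i using Fin.cases with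
    | zero => exact hf.2
    | succ i => exact hg i

end Games

/-! ### The Szlenk derivation -/

section Szlenk

variable {X : Type u} [NormedAddCommGroup X] [NormedSpace ℝ X]

theorem szlenkDerivative_subset (ε : ℝ) (K : Set (WeakDual ℝ X)) : szlenkDerivative ε K ⊆ K :=
  Set.sdiff_subset

theorem szlenkIterate_natCast_nonempty {ε : ℝ} {K : Set (WeakDual ℝ X)}
    (h : Ordinal.omega0 < szlenkIndexAt ε K) (n : ℕ) :
    ((szlenkDerivative ε)^[n] K).Nonempty := by
  have hω : (szlenkIterate ε K Ordinal.omega0).Nonempty := by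
    rw [Set.nonempty_iff_ne_empty]
    intro h0
    exact h.not_ge (iInf₂_le (f := fun (α : Ordinal.{u}) (_ : szlenkIterate ε K α = ∅) =>
      (α : WithTop Ordinal.{u})) _ h0)
  have hn : ∀ n : ℕ, szlenkIterate ε K (n : Ordinal.{u}) = (szlenkDerivative ε)^[n] K := by
    intro n
    induction n with
    | zero => simp [szlenkIterate]
    | succ n ih =>
      rw [Function.iterate_succ_apply', ← ih, Nat.cast_succ]
      exact Ordinal.limitRecOn_add_one ..
  rw [← hn]
  refine hω.mono ?_
  have : szlenkIterate ε K Ordinal.omega0 =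
      ⋂ (γ : Ordinal.{u}) (_ : γ < Ordinal.omega0), szlenkIterate ε K γ :=
    Ordinal.limitRecOn_limit _ _ _ _ Ordinal.isSuccLimit_omega0
  rw [this]
  exact Set.iInter₂_subset (s := fun (γ : Ordinal.{u}) (_ : γ < Ordinal.omega0) =>
    szlenkIterate ε K γ) _ (Ordinal.natCast_lt_omega0 n)

/-- Otherwise `U ∩ K` lies within ε/2 of `y`, so its diameter is at most ε and the derivation
removes `y`. -/
theorem exists_norm_sub_ge_of_mem_szlenkDerivative {ε : ℝ} {K : Set (WeakDual ℝ X)}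
    {y : WeakDual ℝ X} (hy : y ∈ szlenkDerivative ε K) {U : Set (WeakDual ℝ X)} (hU : IsOpen U)
    (hyU : y ∈ U) :
    ∃ z ∈ K, z ∈ U ∧ ε / 2 ≤ ‖WeakDual.toStrongDual z - WeakDual.toStrongDual y‖ := by
  by_contra! h
  refine hy.2 ⟨U ∩ K, ⟨⟨U, hU, rfl⟩, ?_⟩, hyU, hy.1⟩
  refine Metric.ediam_le ?_
  rintro _ ⟨a, ha, rfl⟩ _ ⟨b, hb, rfl⟩
  rw [edist_dist]
  refine ENNReal.ofReal_le_ofReal ?_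
  refine (dist_triangle_right _ _ (WeakDual.toStrongDual y)).trans ?_
  rw [dist_eq_norm, dist_eq_norm]
  linarith [h a ha.2 ha.1, h b hb.2 hb.1]

/-- Each move passes from `y` to a nearby point one derivative lower and plays the normalized
difference. The sum telescopes to a point of the unit ball, up to an error η per move. -/
theorem forallExistsGame_of_mem_szlenkDerivative {ε η : ℝ} (hη : 0 < η)
    (hηε : η ≤ ε / 4) {n : ℕ} {y : WeakDual ℝ X}
    (hy : y ∈ (szlenkDerivative ε)^[n]
      (WeakDual.toStrongDual ⁻¹' Metric.closedBall (0 : StrongDual ℝ X) 1)) :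
    ForallExistsGame X n fun f => ∃ r : Fin n → ℝ, (∀ i, ε / 4 ≤ r i) ∧
      ‖WeakDual.toStrongDual y + ∑ i, r i • f i‖ ≤ 1 + n * η := by
  induction n generalizing y with
  | zero => exact ⟨Fin.elim0, fun i => i.elim0, by simpa using hy⟩
  | succ n ih =>
    intro Y hY
    rw [Function.iterate_succ_apply'] at hy
    obtain ⟨g, hg, hgY⟩ := exists_continuous_linearMap_sub_mem hY
    -- In this weak* neighbourhood, moving `z - y` into `Y` costs less than η ≤ ε/4, so a norm of at
    -- least ε/4 remains.
    have hU : IsOpen {z : WeakDual ℝ X | ‖g (z - y)‖ < η} :=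
      isOpen_lt (hg.comp (continuous_id.sub continuous_const)).norm continuous_const
    obtain ⟨z, hz, hzU, hzy⟩ := exists_norm_sub_ge_of_mem_szlenkDerivative hy hU (by simpa)
    have hzU : ‖g (z - y)‖ < η := hzU
    set v : StrongDual ℝ X := WeakDual.toStrongDual z - WeakDual.toStrongDual y - g (z - y) with hv
    have hvn : ε / 4 ≤ ‖v‖ := by
      have := norm_sub_norm_le (WeakDual.toStrongDual z - WeakDual.toStrongDual y) (g (z - y))
      linarith
    have hv0 : 0 < ‖v‖ := by linarith
    have hvY : StrongDual.toWeakDual v ∈ Y := hgY (z - y)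
    refine ⟨‖v‖⁻¹ • v, ⟨?_, ?_⟩, (ih hz).mono ?_⟩
    · rw [map_smul]
      exact Y.smul_mem _ hvY
    · rw [norm_smul, norm_inv, norm_norm, inv_mul_cancel₀ hv0.ne']
    · rintro f ⟨r, hr, hf⟩
      refine ⟨Fin.cons ‖v‖ r, Fin.cases hvn hr, ?_⟩
      rw [Fin.sum_univ_succ]
      simp only [Fin.cons_zero, Fin.cons_succ, smul_smul, mul_inv_cancel₀ hv0.ne', one_smul]
      have : WeakDual.toStrongDual y + (v + ∑ i, r i • f i) =
          (WeakDual.toStrongDual z + ∑ i, r i • f i) - g (z - y) := by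
        rw [hv]; abel
      rw [this]
      refine (norm_sub_le _ _).trans ?_
      push_cast
      linarith

end Szlenk

/-! ### Upper `ℓ_∞`-estimates in games -/

section Upper

variable {E : Type v} [NormedAddCommGroup E] [NormedSpace ℝ E]

/-- The set of the combinations of a finite sequence with coefficients in `[-1, 1]`. -/
def cubeHull {n : ℕ} (f : Fin n → E) : Set E :=
  {v | ∃ a : Fin n → ℝ, (∀ i, |a i| ≤ 1) ∧ ∑ i, a i • f i = v}

theorem cubeHull_elim0 (f : Fin 0 → E) : cubeHull f = {0} := by
  ext v
  simp [cubeHull, eq_comm]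

theorem mem_cubeHull_cons {n : ℕ} {f : E} {g : Fin n → E} {v : E} :
    v ∈ cubeHull (Fin.cons f g : Fin (n + 1) → E) ↔
      ∃ t : ℝ, |t| ≤ 1 ∧ ∃ w ∈ cubeHull g, t • f + w = v := by
  constructor
  · rintro ⟨a, ha, rfl⟩
    exact ⟨a 0, ha 0, _, ⟨fun i => a i.succ, fun i => ha _, rfl⟩, by simp [Fin.sum_univ_succ]⟩
  · rintro ⟨t, ht, _, ⟨a, ha, rfl⟩, rfl⟩
    exact ⟨Fin.cons t a, Fin.cases ht ha, by simp [Fin.sum_univ_succ]⟩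

theorem smul_mem_cubeHull {n : ℕ} {f : Fin n → E} {v : E} (hv : v ∈ cubeHull f) {t : ℝ}
    (ht : |t| ≤ 1) : t • v ∈ cubeHull f := by
  obtain ⟨a, ha, rfl⟩ := hv
  refine ⟨fun i => t * a i, fun i => ?_, by simp [Finset.smul_sum, smul_smul]⟩
  rw [abs_mul]
  exact mul_le_one₀ ht (abs_nonneg _) (ha i)

/-- The estimate for signs in the definition of unconditionality extends to multipliers in
`[-1, 1]`. -/
theorem IsUnconditionalSeq.norm_sum_le {n : ℕ} {C : ℝ} {f : Fin n → E}
    (hf : IsUnconditionalSeq C f) (a b : Fin n → ℝ) (hb : ∀ i, |b i| ≤ 1) :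
    ‖∑ i, (b i * a i) • f i‖ ≤ C * ‖∑ i, a i • f i‖ := by
  let L : (Fin n → ℝ) →ₗ[ℝ] E :=
    ∑ i, (LinearMap.toSpanSingleton ℝ E (a i • f i)) ∘ₗ LinearMap.proj i
  have hL : ∀ θ, L θ = ∑ i, (θ i * a i) • f i := fun θ => by simp [L, smul_smul]
  have hconv : ConvexOn ℝ Set.univ fun θ => ‖L θ‖ := by
    simpa using! (convexOn_norm (convex_univ (𝕜 := ℝ) (E := E))).comp_linearMap L
  -- The cube is the convex hull of the sign vectors, and a convex function on it is dominated by
  -- its value at some vertex.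
  have hmem : b ∈ convexHull ℝ (Set.univ.pi fun _ : Fin n => ({1, -1} : Set ℝ)) := by
    rw [convexHull_pi]
    intro i _
    rw [convexHull_pair, segment_symm, segment_eq_Icc (by norm_num)]
    exact abs_le.1 (hb i)
  obtain ⟨θ, hθ, h⟩ := hconv.exists_ge_of_mem_convexHull (Set.subset_univ _) hmem
  simp only [hL] at h
  exact h.trans (hf a θ fun i => by simpa using hθ i (Set.mem_univ i))

variable {X : Type u} [NormedAddCommGroup X] [NormedSpace ℝ X]

/-- In the game of length `n`, one can produce sequences with the upper `ℓ_∞`-estimate `K`. -/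
def UpperGame (X : Type u) [NormedAddCommGroup X] [NormedSpace ℝ X] (n : ℕ) (K : ℝ) : Prop :=
  ForallExistsGame X n fun f => ∀ v ∈ cubeHull f, ‖v‖ ≤ K

theorem exists_upperGame (hSz : (Ordinal.omega0 : WithTop Ordinal) < szlenkIndex X)
    (hunc : HasWeakStarUnconditionalAsymptoticStructure X) :
    ∃ K : ℝ, ∀ n, UpperGame X n K := by
  obtain ⟨C, hC, hunc⟩ := hunc
  obtain ⟨ε, hε⟩ := lt_iSup_iff.1 hSz
  obtain ⟨hε0, hε⟩ := lt_iSup_iff.1 hε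
  -- Here 3 bounds `1 + n * η + ‖y‖` for η ≤ 1/n, `C` comes from unconditionality, and `4 / ε`
  -- compensates for `r i ≥ ε / 4`.
  refine ⟨4 / ε * (C * 3), fun n => ?_⟩
  rcases Nat.eq_zero_or_pos n with rfl | hn
  · intro v hv
    rw [cubeHull_elim0] at hv
    rw [Set.mem_singleton_iff.1 hv, norm_zero]
    positivity
  have hn' : (0 : ℝ) < n := Nat.cast_pos.2 hn
  obtain ⟨y, hy⟩ := szlenkIterate_natCast_nonempty hε n
  have hyn : ‖WeakDual.toStrongDual y‖ ≤ 1 := by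
    have : ∀ (n : ℕ) (K : Set (WeakDual ℝ X)), (szlenkDerivative ε)^[n] K ⊆ K := fun n K => by
      induction n with
      | zero => exact subset_rfl
      | succ n ih =>
        rw [Function.iterate_succ_apply']
        exact (szlenkDerivative_subset _ _).trans ih
    simpa using this _ _ hy
  refine ((forallExistsGame_of_mem_szlenkDerivative
    (lt_min (div_pos hε0 four_pos) (inv_pos.2 hn')) (min_le_left _ _) hy).and
      (hunc n hn)).mono ?_
  rintro f ⟨⟨r, hr, hf⟩, hfC⟩ _ ⟨a, ha, rfl⟩
  have h1 : (n : ℝ) * min (ε / 4) (n : ℝ)⁻¹ ≤ 1 :=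
    (mul_le_mul_of_nonneg_left (min_le_right _ _) hn'.le).trans_eq (mul_inv_cancel₀ hn'.ne')
  have h3 : ‖∑ i, r i • f i‖ ≤ 3 := by
    have := norm_sub_le (WeakDual.toStrongDual y + ∑ i, r i • f i) (WeakDual.toStrongDual y)
    rw [add_sub_cancel_left] at this
    linarith
  have hr0 : ∀ i, 0 < r i := fun i => (div_pos hε0 four_pos).trans_le (hr i)
  have h4 := hfC.norm_sum_le r (fun i => ε / 4 * (a i / r i)) fun i => by
    rw [abs_mul, abs_div (a i), abs_of_pos (hr0 i), abs_of_pos (div_pos hε0 four_pos), ← mul_div_assoc,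
      div_le_one (hr0 i)]
    exact (mul_le_of_le_one_right (by positivity) (ha i)).trans (hr i)
  have h5 : ∑ i, a i • f i = (4 / ε) • ∑ i, (ε / 4 * (a i / r i) * r i) • f i := by
    rw [Finset.smul_sum]
    refine Finset.sum_congr rfl fun i _ => ?_
    rw [smul_smul]
    congr 1
    have := (hr0 i).ne'
    field_simp
  rw [h5, norm_smul, Real.norm_of_nonneg (by positivity)]
  gcongr
  exact h4.trans (by gcongr)

/-- The set `S` stores the contributions of moves already made, so the induction can absorb the
first vector into it. -/
theorem ForallExistsGame.split {n m : ℕ} {K : ℝ} {S : Set (StrongDual ℝ X)}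
    (h : ForallExistsGame X (n + m) fun f => ∀ u ∈ S, ∀ v ∈ cubeHull f, ‖u + v‖ ≤ K) :
    ForallExistsGame X n fun f => ForallExistsGame X m fun g =>
      ∀ u ∈ S, ∀ v ∈ cubeHull f, ∀ w ∈ cubeHull g, ‖u + v + w‖ ≤ K := by
  induction n generalizing S with
  | zero =>
    rw [Nat.zero_add] at h
    change ForallExistsGame X m _
    refine h.mono fun g hg u hu v hv w hw => ?_
    rw [cubeHull_elim0] at hv
    simpa [Set.mem_singleton_iff.1 hv] using hg u hu w hw
  | succ n ih =>
    rw [Nat.add_right_comm] at h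
    intro Y hY
    obtain ⟨f, hf, h⟩ := h Y hY
    refine ⟨f, hf, ?_⟩
    have h' := ih (S := {u | ∃ u' ∈ S, ∃ t : ℝ, |t| ≤ 1 ∧ u' + t • f = u})
      (h.mono (by
        rintro g hg _ ⟨u, hu, t, ht, rfl⟩ v hv
        rw [add_assoc]
        exact hg u hu _ (mem_cubeHull_cons.2 ⟨t, ht, v, hv, rfl⟩)))
    refine h'.mono fun g hg => hg.mono fun g' hg' u hu v hv w hw => ?_
    obtain ⟨t, ht, v', hv', rfl⟩ := mem_cubeHull_cons.1 hv
    rw [← add_assoc u]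
    exact hg' _ ⟨u, hu, t, ht, rfl⟩ v' hv' w hw

/-- Blocking: if one can produce sequences of length `m * n` with an upper estimate `K`, and the
opponent can enforce a large vector in every `n` moves, then one can improve the estimate. -/
theorem ForallExistsGame.blocks {n m : ℕ} {K r : ℝ} (hr : 0 < r) {S : Set (StrongDual ℝ X)}
    (h : ForallExistsGame X (m * n) fun f => ∀ u ∈ S, ∀ v ∈ cubeHull f, ‖u + v‖ ≤ K)
    (hn : ExistsForallGame X n fun f => ∃ v ∈ cubeHull f, r < ‖v‖) :
    ForallExistsGame X m fun f => ∀ u ∈ S, ∀ v ∈ cubeHull f, ‖u + r • v‖ ≤ K := by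
  induction m generalizing S with
  | zero =>
    rw [Nat.zero_mul] at h
    intro u hu v hv
    have hv' := hv
    rw [cubeHull_elim0] at hv'
    have := h u hu v hv
    rw [Set.mem_singleton_iff.1 hv'] at this ⊢
    simpa using this
  | succ m ih =>
    intro Y hY
    rw [Nat.succ_mul, Nat.add_comm] at h
    -- One block is played inside `Y` against the forcing strategy. It contains a large `v`, while
    -- `hf` keeps the remaining `m * n` moves winnable.
    obtain ⟨f, ⟨hf, v, hv, hrv⟩, hfY⟩ :=
      ((h.split.and hn).and (ExistsForallGame.forall_mem n hY)).exists
    have hv0 : 0 < ‖v‖ := hr.trans hrv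
    refine ⟨‖v‖⁻¹ • v, ⟨?_, ?_⟩, ?_⟩
    · obtain ⟨a, -, rfl⟩ := hv
      simp only [map_smul, map_sum]
      exact Y.smul_mem _ (Y.sum_mem fun i _ => Y.smul_mem _ (hfY i))
    · rw [norm_smul, norm_inv, norm_norm, inv_mul_cancel₀ hv0.ne']
    · have h' := ih (S := {u | ∃ u' ∈ S, ∃ t : ℝ, |t| ≤ 1 ∧ u' + t • v = u})
        (hf.mono (by
          rintro g hg _ ⟨u, hu, t, ht, rfl⟩ w hw
          exact hg u hu _ (smul_mem_cubeHull hv ht) w hw))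
      refine h'.mono fun g hg u hu w hw => ?_
      obtain ⟨t, ht, w', hw', rfl⟩ := mem_cubeHull_cons.1 hw
      -- Scaling by `r` keeps the coefficient of `v` in `[-1, 1]`, since `‖v‖ > r`.
      have := hg (u + (r * t * ‖v‖⁻¹) • v) ⟨u, hu, _, ?_, rfl⟩ w' hw'
      · rwa [smul_add, smul_smul, smul_smul, ← add_assoc]
      · rw [abs_mul, abs_mul, abs_of_pos hr, abs_of_pos (inv_pos.2 hv0), ← div_eq_mul_inv,
          div_le_one hv0]
        exact (mul_le_of_le_one_right hr.le ht).trans hrv.le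

/-- James' non-distortion argument for `ℓ_∞`, in games. -/
theorem upperGame_of_sq {r : ℝ} (hr : 0 < r) (h : ∀ n, UpperGame X n (r ^ 2)) (n : ℕ) :
    UpperGame X n r := by
  by_contra hn
  have hn' := ExistsForallGame.of_not hn
  simp only [not_forall, not_le, exists_prop] at hn'
  -- With `n` blocks of length `n`, the bound `r ^ 2` on `r • v` gives `r` on `v`.
  refine hn ((ForallExistsGame.blocks (S := {0}) (m := n) (K := r ^ 2) hr
    ((h (n * n)).mono fun f hf u hu v hv => ?_) hn').mono ?_)
  · rw [Set.mem_singleton_iff.1 hu, zero_add]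
    exact hf v hv
  · intro f hf v hv
    have := hf 0 rfl v hv
    rw [zero_add, norm_smul, Real.norm_of_nonneg hr.le, sq] at this
    exact le_of_mul_le_mul_left this hr

theorem upperGame_of_one_lt {K : ℝ} (h : ∀ n, UpperGame X n K) {r : ℝ} (hr : 1 < r) (n : ℕ) :
    UpperGame X n r := by
  obtain ⟨k, hk⟩ := pow_unbounded_of_one_lt K hr
  have key : ∀ j : ℕ, (∀ n, UpperGame X n (r ^ 2 ^ j)) → ∀ n, UpperGame X n r := by
    intro j
    induction j with
    | zero => exact fun h => by simpa using h
    | succ j ih =>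
      refine fun h => ih (upperGame_of_sq (by positivity) fun n => ?_)
      rw [← pow_mul, ← pow_succ]
      exact h n
  refine key k (fun n => (h n).mono fun f hf v hv => (hf v hv).trans (hk.le.trans ?_)) n
  exact pow_le_pow_right₀ hr.le Nat.lt_two_pow_self.le

/-- A normalized sequence with an upper `ℓ_∞`-estimate close to `1` is almost isometrically
equivalent to the unit vector basis of `ℓ_∞`. -/
theorem isEquivalentSeq_basisFun {n : ℕ} {f : Fin n → E} {t : ℝ} (ht0 : 0 ≤ t) (ht : t < 1)
    (hf1 : ∀ i, ‖f i‖ = 1) (hf : ∀ v ∈ cubeHull f, ‖v‖ ≤ 1 + t) {C : ℝ}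
    (hC : (1 + t) / (1 - t) ≤ C) :
    IsEquivalentSeq C f fun i => Pi.basisFun ℝ (Fin n) i := by
  have ht' : 0 < 1 - t := sub_pos.2 ht
  refine ⟨(1 - t)⁻¹, 1 + t, inv_pos.2 ht', by linarith, by rwa [mul_comm, ← div_eq_mul_inv],
    fun a => ?_⟩
  have ha : ∑ i, a i • (Pi.basisFun ℝ (Fin n) i) = a := by
    simpa using (Pi.basisFun ℝ (Fin n)).sum_repr a
  rw [ha, inv_inv]
  have hup : ∀ b : Fin n → ℝ, ∀ M : ℝ, 0 < M → (∀ i, |b i| ≤ M) →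
      ‖∑ i, b i • f i‖ ≤ (1 + t) * M := by
    intro b M hM hb
    have := hf _ ⟨fun i => M⁻¹ * b i, fun i => ?_, rfl⟩
    · simp_rw [mul_smul, ← Finset.smul_sum] at this
      rw [norm_smul, norm_inv, Real.norm_of_nonneg hM.le, ← div_eq_inv_mul, div_le_iff₀ hM] at this
      exact this
    · rw [abs_mul, abs_of_pos (inv_pos.2 hM), ← div_eq_inv_mul, div_le_one hM]
      exact hb i
  rcases eq_or_ne a 0 with rfl | ha0
  · simp
  have hn : 0 < ‖a‖ := norm_pos_iff.2 ha0
  refine ⟨?_, hup a _ hn fun i => norm_le_pi_norm a i⟩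
  obtain ⟨j, hj⟩ : ∃ j, ‖a j‖ = ‖a‖ := by
    have : Nonempty (Fin n) := by
      by_contra h
      rw [not_nonempty_iff] at h
      exact ha0 (Subsingleton.elim _ _)
    obtain ⟨j, hj⟩ := Finite.exists_max fun i => ‖a i‖
    exact ⟨j, le_antisymm (norm_le_pi_norm a j) ((pi_norm_le_iff_of_nonneg (norm_nonneg _)).2 hj)⟩
  have h1 := hup (fun i => if i = j then a i else - a i) ‖a‖ hn fun i => by
    split_ifs
    · exact norm_le_pi_norm a i
    · rw [abs_neg]
      exact norm_le_pi_norm a i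
  -- Flipping all signs except at a maximal coordinate leaves `2 * a j • f j` as the sum; the upper
  -- estimate for the flipped part gives the lower bound `2 - (1 + t) = 1 - t`.
  have h2 : (2 * a j) • f j = ∑ i, a i • f i + ∑ i, (if i = j then a i else - a i) • f i := by
    rw [← Finset.sum_add_distrib, Finset.sum_eq_single j]
    · simp [two_mul, add_smul]
    · intro i _ hi
      simp [hi]
    · simp
  have h3 := congrArg norm h2
  rw [norm_smul, hf1, mul_one, norm_mul, hj, Real.norm_two] at h3
  have h4 := norm_add_le (∑ i, a i • f i) (∑ i, (if i = j then a i else - a i) • f i)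
  linarith

theorem inWeakStarAsymptoticStructure_basisFun
    (hSz : (Ordinal.omega0 : WithTop Ordinal) < szlenkIndex X)
    (hunc : HasWeakStarUnconditionalAsymptoticStructure X) (n : ℕ) :
    InWeakStarAsymptoticStructure X (Pi.basisFun ℝ (Fin n)) := by
  intro ε hε
  obtain ⟨K, hK⟩ := exists_upperGame hSz hunc
  -- This is the solution `t` of `(1 + t) / (1 - t) = 1 + ε`.
  have ht : 0 < ε / (2 + ε) := by positivity
  have ht1 : ε / (2 + ε) < 1 := by rw [div_lt_one (by positivity)]; linarith
  refine ((upperGame_of_one_lt hK (lt_add_of_pos_right 1 ht) n).and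
    (ExistsForallGame.forall_norm_eq_one n)).mono fun f hf => ?_
  refine isEquivalentSeq_basisFun ht.le ht1 hf.2 hf.1 (le_of_eq ?_)
  have : 1 - ε / (2 + ε) = 2 / (2 + ε) := by field_simp; ring
  rw [this]
  field_simp
  ring

end Upper

/-! ### Grünblum's criterion -/

section Basic

open Filter Topology

variable {E : Type v} [NormedAddCommGroup E] [NormedSpace ℝ E] [CompleteSpace E]

/-- Grünblum's criterion: a sequence of nonzero vectors whose partial sums are controlled by `D` is
`D`-basic. -/
theorem isBasicSeq_of_norm_sum_le {D : ℝ} {x : ℕ → E} (hx : ∀ i, x i ≠ 0)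
    (h : ∀ (a : ℕ → ℝ) (m n : ℕ), m ≤ n →
      ‖∑ i ∈ Finset.range m, a i • x i‖ ≤ D * ‖∑ i ∈ Finset.range n, a i • x i‖) :
    IsBasicSeq D x := by
  set G := (Submodule.span ℝ (Set.range x)).topologicalClosure
  have : CompleteSpace G :=
    (Submodule.isClosed_topologicalClosure (Submodule.span ℝ (Set.range x))).completeSpace_coe
  have hD : 0 ≤ D := by
    have h1 : ‖x 0‖ ≤ D * ‖x 0‖ := by simpa using h 1 1 1 le_rfl
    have h0 : 0 < ‖x 0‖ := norm_pos_iff.2 (hx 0)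
    by_contra! hD
    nlinarith
  let y : ℕ → G := fun i =>
    ⟨x i, Submodule.le_topologicalClosure _ (Submodule.subset_span ⟨i, rfl⟩)⟩
  let e : (ℕ →₀ ℝ) →ₗ[ℝ] G := Finsupp.linearCombination ℝ y
  have he : ∀ (c : ℕ →₀ ℝ) (n : ℕ), c.support ⊆ Finset.range n →
      e c = ∑ i ∈ Finset.range n, c i • y i := fun c n hc =>
    (Finsupp.linearCombination_apply ℝ c).trans (Finsupp.sum_of_support_subset c hc _ (by simp))
  have hdense : DenseRange e := by
    have hr : Set.range (fun c => (e c : E)) = Submodule.span ℝ (Set.range x) := by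
      rw [← Finsupp.range_linearCombination]
      ext z
      simp only [Set.mem_range, SetLike.mem_coe, LinearMap.mem_range]
      have : ∀ c, (e c : E) = Finsupp.linearCombination ℝ x c := fun c => by
        simp [e, y, Finsupp.linearCombination_apply, Finsupp.sum]
      simp only [this]
    intro z
    rw [Topology.IsInducing.subtypeVal.closure_eq_preimage_closure_image, ← Set.range_comp]
    change (z : E) ∈ closure (Set.range fun c => (e c : E))
    rw [hr]
    exact z.2
  have hbound : ∀ (c : ℕ →₀ ℝ) (k : ℕ), ‖∑ i ∈ Finset.range k, c i • y i‖ ≤ D * ‖e c‖ := by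
    intro c k
    obtain ⟨n, hn⟩ := c.support.exists_nat_subset_range
    rw [he c (max n k) (hn.trans (Finset.range_mono (le_max_left _ _)))]
    simpa [y] using h c k (max n k) (le_max_right _ _)
  -- A coordinate is a difference of consecutive partial sums, so it is bounded and extends from the
  -- dense span.
  have hcoord : ∀ i, ∀ c : ℕ →₀ ℝ, ‖(Finsupp.lapply i : (ℕ →₀ ℝ) →ₗ[ℝ] ℝ) c‖ ≤
      (2 * D / ‖x i‖) * ‖e c‖ := by
    intro i c
    rw [div_mul_eq_mul_div, le_div_iff₀ (norm_pos_iff.2 (hx i))]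
    have h1 : c i • y i =
        ∑ j ∈ Finset.range (i + 1), c j • y j - ∑ j ∈ Finset.range i, c j • y j := by
      rw [Finset.sum_range_succ, add_sub_cancel_left]
    have h2 : ‖c i • y i‖ = ‖c i‖ * ‖x i‖ := norm_smul _ _
    rw [Finsupp.lapply_apply, ← h2, h1]
    refine (norm_sub_le _ _).trans ?_
    linarith [hbound c (i + 1), hbound c i]
  let coord : ℕ → StrongDual ℝ G := fun i =>
    (Finsupp.lapply i : (ℕ →₀ ℝ) →ₗ[ℝ] ℝ).extendOfNorm e
  have hcoord_eq : ∀ i c, coord i (e c) = c i := fun i c =>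
    LinearMap.extendOfNorm_eq hdense ⟨_, hcoord i⟩ c
  let P : ℕ → G →L[ℝ] G := fun k => ∑ i ∈ Finset.range k, (coord i).smulRight (y i)
  have hP_apply : ∀ k z, P k z = ∑ i ∈ Finset.range k, coord i z • y i := fun k z => by
    simp [P]
  have hP : ∀ k z, ‖P k z‖ ≤ D * ‖z‖ := fun k z =>
    hdense.induction_on z (isClosed_le (by fun_prop) (by fun_prop)) fun c => by
      rw [hP_apply]
      simpa only [hcoord_eq] using hbound c k
  have htend : ∀ z, Tendsto (fun k => P k z) atTop (𝓝 z) := by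
    intro z
    rw [Metric.tendsto_atTop]
    intro δ hδ
    have hδ' : 0 < δ / (D + 2) := by positivity
    obtain ⟨c, hc⟩ := hdense.exists_dist_lt z hδ'
    obtain ⟨n, hn⟩ := c.support.exists_nat_subset_range
    refine ⟨n, fun k hk => ?_⟩
    have h1 : P k (e c) = e c := by
      rw [hP_apply, he c k (hn.trans (Finset.range_mono hk))]
      simp only [← he c k (hn.trans (Finset.range_mono hk)), hcoord_eq]
    have h2 : P k z - z = P k (z - e c) - (z - e c) := by
      rw [map_sub, h1]; abel
    rw [dist_eq_norm] at hc ⊢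
    rw [h2]
    refine (norm_sub_le _ _).trans_lt ?_
    have h3 := hP k (z - e c)
    have h4 : (D + 2) * ‖z - e c‖ < δ := by rwa [mul_comm, ← lt_div_iff₀ (by positivity)]
    linarith [norm_nonneg (z - e c)]
  let b : SchauderBasis ℝ G :=
    { basis := y
      coord := coord
      ortho := fun i j => by
        have : e (Finsupp.single j 1) = y j := by simp [e]
        rw [← this, hcoord_eq, Finsupp.single_eq_pi_single]
        congr!
      expansion := fun z => by
        rw [HasSum, SummationFilter.conditional_filter_eq_map_range, tendsto_map'_iff]
        exact (htend z).congr fun k => hP_apply k z }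
  refine ⟨b, fun i => rfl, fun k => ContinuousLinearMap.opNorm_le_bound _ hD fun z => ?_⟩
  rw [SchauderBasis.proj_apply, ← hP_apply]
  exact hP k z

/-- A sequence each of whose terms is almost monotonically complemented to the span of the previous
ones is basic. -/
theorem isBasicSeq_of_step {D : ℝ} {x : ℕ → E} (hx : ∀ i, x i ≠ 0) {c : ℕ → ℝ} (hc1 : ∀ i, 1 ≤ c i)
    (hcD : ∀ i, c i ≤ D)
    (h : ∀ i, ∀ u ∈ Submodule.span ℝ (x '' Set.Iio i), ∀ t : ℝ,
      c i * ‖u‖ ≤ c (i + 1) * ‖u + t • x i‖) :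
    IsBasicSeq D x := by
  refine isBasicSeq_of_norm_sum_le hx fun a m n hmn => ?_
  have key : c m * ‖∑ i ∈ Finset.range m, a i • x i‖ ≤ c n * ‖∑ i ∈ Finset.range n, a i • x i‖ := by
    induction n, hmn using Nat.le_induction with
    | base => exact le_rfl
    | succ n _ ih =>
      refine ih.trans ?_
      rw [Finset.sum_range_succ]
      exact h n _ (Submodule.sum_mem _ fun i hi => Submodule.smul_mem _ _
        (Submodule.subset_span ⟨i, Finset.mem_range.1 hi, rfl⟩)) _
  calc ‖∑ i ∈ Finset.range m, a i • x i‖ ≤ c m * ‖∑ i ∈ Finset.range m, a i • x i‖ :=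
        le_mul_of_one_le_left (norm_nonneg _) (hc1 m)
    _ ≤ _ := key
    _ ≤ _ := mul_le_mul_of_nonneg_right (hcD n) (norm_nonneg _)

end Basic

/-! ### Strategies along a tree -/

section Positions

variable {X : Type u} [NormedAddCommGroup X] [NormedSpace ℝ X]

/-- The position reached after the moves `l` is winning in the game `ForallExistsGame`. -/
def WinningPosition : (n : ℕ) → ((Fin n → StrongDual ℝ X) → Prop) → List (StrongDual ℝ X) → Prop
  | n, P, [] => ForallExistsGame X n P
  | 0, _, _ :: _ => False
  | n + 1, P, f :: l => WinningPosition n (fun g => P (Fin.cons f g)) l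

theorem WinningPosition.exists_append {n : ℕ} {P : (Fin n → StrongDual ℝ X) → Prop}
    {l : List (StrongDual ℝ X)} (h : WinningPosition n P l) (hl : l.length < n)
    {Y : Submodule ℝ (WeakDual ℝ X)} (hY : Y ∈ weakStarCof X) :
    ∃ f ∈ dualSphere X Y, WinningPosition n P (l ++ [f]) := by
  induction l generalizing n with
  | nil =>
    obtain ⟨n, rfl⟩ := Nat.exists_eq_succ_of_ne_zero hl.ne'
    obtain ⟨f, hf, hg⟩ := h Y hY
    exact ⟨f, hf, by simpa [WinningPosition] using hg⟩
  | cons g l ih =>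
    obtain ⟨n, rfl⟩ := Nat.exists_eq_succ_of_ne_zero (Nat.ne_zero_of_lt hl)
    exact ih (n := n) h (by simpa using hl)

theorem WinningPosition.getD {n : ℕ} {P : (Fin n → StrongDual ℝ X) → Prop}
    {l : List (StrongDual ℝ X)} (h : WinningPosition n P l) (hl : l.length = n) :
    P fun i => l.getD i 0 := by
  induction l generalizing n with
  | nil =>
    subst hl
    exact Eq.mp (congrArg P (funext fun i : Fin 0 => i.elim0)) (h : P Fin.elim0)
  | cons f l ih =>
    subst hl
    have := ih (n := l.length) h rfl
    convert this using 1
    ext i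
    induction i using Fin.cases with
    | zero => rfl
    | succ i => simp

end Positions

/-- Recursive choice of a sequence, each condition involving only the terms up to that point. -/
theorem exists_seq_of_forall_update {α : Type v} [Nonempty α] (Q : ℕ → (ℕ → α) → Prop)
    (hQ : ∀ i y z, (∀ j ≤ i, y j = z j) → Q i y → Q i z)
    (h : ∀ i y, (∀ j < i, Q j y) → ∃ a, Q i (Function.update y i a)) :
    ∃ y, ∀ i, Q i y := by
  have step : ∀ i y, ∃ a, (∀ j < i, Q j y) → Q i (Function.update y i a) := fun i y => by
    by_cases hy : ∀ j < i, Q j y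
    · exact (h i y hy).imp fun a ha _ => ha
    · exact ⟨Classical.arbitrary α, fun h => (hy h).elim⟩
  choose a ha using step
  let z : ℕ → ℕ → α := fun n => Nat.rec (fun _ => Classical.arbitrary α)
    (fun i y => Function.update y i (a i y)) n
  have hz : ∀ n, z (n + 1) = Function.update (z n) n (a n (z n)) := fun n => rfl
  have hstab : ∀ n m j, n ≤ m → j < n → z m j = z n j := by
    intro n m j hnm hj
    induction m, hnm using Nat.le_induction with
    | base => rfl
    | succ m hm ih => rw [hz, Function.update_of_ne (hj.trans_le hm).ne, ih]
  have hgood : ∀ n, ∀ j < n, Q j (z n) := by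
    intro n
    induction n with
    | zero => exact fun j hj => absurd hj (Nat.not_lt_zero j)
    | succ n ih =>
      intro j hj
      rcases Nat.lt_succ_iff_lt_or_eq.1 hj with hj | rfl
      · exact hQ j (z n) _ (fun k hk => (hstab n (n + 1) k n.le_succ (hk.trans_lt hj)).symm) (ih j hj)
      · rw [hz]
        exact ha j (z j) ih
  refine ⟨fun i => z (i + 1) i, fun i => hQ i (z (i + 1)) _ (fun j hj => ?_)
    (hgood (i + 1) i i.lt_succ_self)⟩
  exact hstab (j + 1) (i + 1) j (Nat.succ_le_succ hj) j.lt_succ_self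

/-! ### Good trees from winning strategies -/

section Trees

variable {N : ℕ}

theorem CTree.restrict_length (s : CTree N) : s.restrict s.1.length = s :=
  Subtype.ext (List.take_length ..)

theorem CTree.restrict_restrict (s : CTree N) {j k : ℕ} (h : j ≤ k) :
    (s.restrict k).restrict j = s.restrict j :=
  Subtype.ext (by simp [CTree.restrict, List.take_take, min_eq_left h])

theorem CTree.length_restrict (s : CTree N) {k : ℕ} (h : k ≤ s.1.length) :
    (s.restrict k).1.length = k := by
  simp [CTree.restrict, h]

theorem IsCompatibleOrdering.symm_restrict_lt {σ : ℕ ≃ CTree N} (hσ : IsCompatibleOrdering σ)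
    (i : ℕ) {k : ℕ} (hk : k < (σ i).1.length) : σ.symm ((σ i).restrict k) < i := by
  obtain ⟨j, hj, h⟩ := hσ i ((σ i).restrict k) (List.take_prefix k (σ i).1) fun h => by
    have := (σ i).length_restrict hk.le
    rw [h] at this
    exact hk.ne' this
  rwa [h, Equiv.symm_apply_apply]

/-- The values `y` of the `n` first nodes of the branch to `s`. -/
def branch {α : Type v} (σ : ℕ ≃ CTree N) (y : ℕ → α) (s : CTree N) (n : ℕ) : List α :=
  (List.range n).map fun k => y (σ.symm (s.restrict k))

variable {X : Type u} [NormedAddCommGroup X] [NormedSpace ℝ X]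

theorem containsGoodEllInftyTrees_strongDual
    (h : ∀ n : ℕ, InWeakStarAsymptoticStructure X (Pi.basisFun ℝ (Fin n))) :
    ContainsGoodEllInftyTrees (StrongDual ℝ X) := by
  intro N _ ε hε σ hσ
  let P : (Fin (N + 1) → StrongDual ℝ X) → Prop := fun f =>
    IsEquivalentSeq (1 * (1 + ε)) f fun i => Pi.basisFun ℝ (Fin (N + 1)) i
  have hP : ForallExistsGame X (N + 1) P := h (N + 1) ε hε
  -- Strictly increasing from 1 and bounded by `1 + ε`: the loss factors `c (i + 1) / c i > 1`
  -- telescope to a product of at most `1 + ε`.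
  let c : ℕ → ℝ := fun i => 1 + ε * (1 - (1 / 2) ^ i)
  have hc1 : ∀ i, 1 ≤ c i := fun i => by
    have : (1 / 2 : ℝ) ^ i ≤ 1 := pow_le_one₀ (by norm_num) (by norm_num)
    have := mul_nonneg hε.le (sub_nonneg.2 this)
    simp only [c]
    linarith
  have hcD : ∀ i, c i ≤ 1 + ε := fun i => by
    have : 0 ≤ ε * (1 / 2 : ℝ) ^ i := by positivity
    simp only [c]
    linarith
  have hcs : ∀ i, c i < c (i + 1) := fun i => by
    have : 0 < ε * (1 / 2 : ℝ) ^ i := by positivity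
    simp only [c, pow_succ]
    linarith
  let Q : ℕ → (ℕ → StrongDual ℝ X) → Prop := fun i y => ‖y i‖ = 1 ∧
      (∀ u ∈ Submodule.span ℝ (y '' Set.Iio i), ∀ t : ℝ,
        c i * ‖u‖ ≤ c (i + 1) * ‖u + t • y i‖) ∧
      WinningPosition (N + 1) P (branch σ y (σ i) ((σ i).1.length + 1))
  suffices ∃ y, ∀ i, Q i y by
    obtain ⟨y, hy⟩ := this
    refine ⟨fun s => y (σ.symm s), fun s => (hy _).1, fun s hs => ?_, ?_⟩
    · have h1 := (hy (σ.symm s)).2.2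
      rw [Equiv.apply_symm_apply, hs] at h1
      obtain ⟨A, B, hA, hB, hAB, hAB'⟩ := h1.getD (by simp [branch])
      refine ⟨A, B, hA, hB, hAB.trans ?_, ?_⟩
      · nlinarith
      · have hbr : ∀ i : Fin (N + 1), (branch σ y s (N + 1)).getD i 0 =
            y (σ.symm (s.restrict i)) := fun i => by
          simp [branch, List.getElem?_range i.2]
        simpa only [hbr] using hAB'
    · simp only [Equiv.symm_apply_apply]
      exact isBasicSeq_of_step (fun i => norm_ne_zero_iff.1 ((hy i).1 ▸ one_ne_zero)) hc1 hcD
        fun i => (hy i).2.1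
  refine exists_seq_of_forall_update Q ?_ ?_
  · rintro i y z hyz ⟨h1, h2, h3⟩
    refine ⟨hyz i le_rfl ▸ h1, ?_, ?_⟩
    · rwa [← hyz i le_rfl, ← Set.image_congr fun j hj => hyz j (Set.mem_Iio.1 hj).le]
    · convert h3 using 1
      refine List.map_congr_left fun k hk => (hyz _ ?_).symm
      rcases (Nat.lt_succ_iff.1 (List.mem_range.1 hk)).lt_or_eq with hk | rfl
      · exact (hσ.symm_restrict_lt i hk).le
      · rw [CTree.restrict_length, Equiv.symm_apply_apply]
  · intro i y hy
    -- At the root this is the winning game itself; elsewhere it is the condition already secured at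
    -- the parent, which precedes in the ordering.
    have hpre : WinningPosition (N + 1) P (branch σ y (σ i) (σ i).1.length) := by
      rcases Nat.eq_zero_or_pos (σ i).1.length with h0 | hpos
      · rw [h0]
        simpa [branch, WinningPosition] using hP
      · obtain ⟨k, hk⟩ := Nat.exists_eq_succ_of_ne_zero hpos.ne'
        have hk' : k < (σ i).1.length := hk ▸ k.lt_succ_self
        have h1 := (hy _ (hσ.symm_restrict_lt i hk')).2.2
        rw [Equiv.apply_symm_apply, CTree.length_restrict _ hk'.le] at h1
        rw [hk]
        convert h1 using 1
        refine List.map_congr_left fun j hj => ?_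
        rw [CTree.restrict_restrict _ (Nat.lt_succ_iff.1 (List.mem_range.1 hj))]
    have hc0 : 0 < c i := one_pos.trans_le (hc1 i)
    have : FiniteDimensional ℝ (Submodule.span ℝ (y '' Set.Iio i)) :=
      FiniteDimensional.span_of_finite ℝ ((Set.finite_Iio i).image y)
    obtain ⟨Y, hY, hYm⟩ := exists_mem_weakStarCof_norm_le (Submodule.span ℝ (y '' Set.Iio i))
      ((one_lt_div hc0).2 (hcs i))
    obtain ⟨f, hf, hW⟩ := hpre.exists_append (by
      simpa [branch] using Nat.lt_succ_iff.2 (σ i).2) hY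
    refine ⟨f, ?_, ?_, ?_⟩
    · rw [Function.update_self]
      exact hf.2
    · have himg : Function.update y i f '' Set.Iio i = y '' Set.Iio i :=
        Set.image_congr fun j hj => Function.update_of_ne (Set.mem_Iio.1 hj).ne f y
      rw [Function.update_self, himg]
      intro u hu t
      have h1 := hYm u hu (t • f) (by rw [map_smul]; exact Y.smul_mem t hf.1)
      rw [div_mul_eq_mul_div, le_div_iff₀ hc0] at h1
      linarith
    · convert hW using 1
      rw [branch, List.range_succ, List.map_append, List.map_singleton, CTree.restrict_length,
        Equiv.symm_apply_apply, Function.update_self]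
      congr 1
      refine List.map_congr_left fun k hk => ?_
      exact Function.update_of_ne (hσ.symm_restrict_lt i (List.mem_range.1 hk)).ne _ _

end Trees

end DualTrees

end

theorem mainTheorem4 {X : Type*} [NormedAddCommGroup X] [NormedSpace ℝ X] [CompleteSpace X]
    [TopologicalSpace.SeparableSpace X]
    (hSz : (Ordinal.omega0 : WithTop Ordinal) < DualTrees.szlenkIndex X)
    (hunc : DualTrees.HasWeakStarUnconditionalAsymptoticStructure X) :
    (∀ n : ℕ, 1 ≤ n →
      DualTrees.InWeakStarAsymptoticStructure X (Pi.basisFun ℝ (Fin n))) ∧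
    DualTrees.ContainsGoodEllInftyTrees (StrongDual ℝ X) := by
  have h := DualTrees.inWeakStarAsymptoticStructure_basisFun hSz hunc
  exact ⟨fun n _ => h n, DualTrees.containsGoodEllInftyTrees_strongDual h⟩
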